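/- All graphs are finite and simple. A set $D$ of vertices of a graph $G$ is \emph{dominating} if every vertex outside $D$ has a neighbour in $D$; $\gamma(G)$ is the minimum cardinality of a dominating set. For a set $F\subseteq E(G)$, let $G_F$ be the graph obtained from $G$ by subdividing each edge in $F$ exactly once. The \emph{domination subdivision number} $\mathrm{sd}(G)$ is the minimum cardinality of a set $F\subseteq E(G)$ with $\gamma(G_F)>\gamma(G)$. For $q\ge 1$, the graph $G$ is \emph{$q$-critical} if $q$ is the least integer $k$ with $1\le k\le |E(G)|$ such that $\gamma(G_F)>\gamma(G)$ for every $F\subseteq E(G)$ with $|F|=k$. \textbf{Theorem.} Let $T$ be a tree of order at least $3$. Then $T$ is $2$-critical and $\mathrm{sd}(T)=2$ if and only if $T$ is isomorphic to the path $P_{3k+2}$ on $3k+2$ vertices for some integer $k\ge 1$. -/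

import Mathlib

namespace SimpleGraph

variable {V : Type*}

/-- `D` is a dominating set: every vertex outside `D` has at least one neighbour in `D`. -/
def IsDominating (G : SimpleGraph V) (D : Finset V) : Prop :=
  ∀ v, v ∉ D → ∃ u ∈ D, G.Adj v u

/-- The domination number: the minimum cardinality of a dominating set (of a finite graph). -/
noncomputable def dominationNumber (G : SimpleGraph V) : ℕ :=
  sInf {k : ℕ | ∃ D : Finset V, G.IsDominating D ∧ D.card = k}

/-- Adjacency in the graph obtained by subdividing the edges in `F`; the vertex `Sum.inr e` is the
subdivision vertex of the edge `e ∈ F`. -/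
def SubdivideAdj (G : SimpleGraph V) (F : Finset (Sym2 V)) : V ⊕ F → V ⊕ F → Prop
  | Sum.inl u, Sum.inl v => G.Adj u v ∧ s(u, v) ∉ F
  | Sum.inl u, Sum.inr e => u ∈ (e : Sym2 V)
  | Sum.inr e, Sum.inl v => v ∈ (e : Sym2 V)
  | Sum.inr _, Sum.inr _ => False

/-- The graph obtained from `G` by subdividing every edge in `F` exactly once
(used for `F` contained in the edge set of `G`). -/
def subdivide (G : SimpleGraph V) (F : Finset (Sym2 V)) : SimpleGraph (V ⊕ F) where
  Adj := G.SubdivideAdj F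
  symm := by
    constructor
    rintro (u | e) (v | f) h
    · exact ⟨h.1.symm, by rw [Sym2.eq_swap]; exact h.2⟩
    · exact h
    · exact h
    · exact h
  loopless := by
    constructor
    rintro (u | e) h
    · exact h.1.ne rfl
    · exact h

/-- Subdividing the edges in `F` increases the domination number. -/
def SubdivisionIncreases (G : SimpleGraph V) (F : Finset (Sym2 V)) : Prop :=
  G.dominationNumber < (G.subdivide F).dominationNumber

/-- The domination subdivision number `sd(G)`: the minimum number of edges whose subdivision
(each edge at most once) increases the domination number. -/
noncomputable def sd (G : SimpleGraph V) : ℕ :=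
  sInf {k : ℕ | ∃ F : Finset (Sym2 V),
    (F : Set (Sym2 V)) ⊆ G.edgeSet ∧ F.card = k ∧ G.SubdivisionIncreases F}

/-- `G` is `γ`-`q`-critical: `q` is the least `k ≥ 1` such that `G` has a set of `k` edges and
subdividing any set of `k` edges increases the domination number. -/
def IsGammaCritical (G : SimpleGraph V) (q : ℕ) : Prop :=
  IsLeast {k : ℕ | 1 ≤ k ∧
    (∃ F : Finset (Sym2 V), (F : Set (Sym2 V)) ⊆ G.edgeSet ∧ F.card = k) ∧
    ∀ F : Finset (Sym2 V), (F : Set (Sym2 V)) ⊆ G.edgeSet → F.card = k →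
      G.SubdivisionIncreases F} q

end SimpleGraph

namespace SimpleGraph

/-! ### Domination in subdivided graphs, and the branches of a tree at a vertex. -/

section Basic

variable {V : Type*}

/-! For a path on `n` vertices `γ = ⌈n/3⌉`, and subdividing `j` edges gives a path on `n + j`
vertices. Hence one subdivision never raises `γ` while two always do exactly when `n ≡ 2 (mod 3)`.

It remains to see that a tree with this subdivision behaviour is a path, i.e. has no vertex `v` of
degree at least 3 (`IsTree.card_le_two_of_critical`). Let `a x` be the least number of vertices in
the branch of `T - v` at a neighbour `x` that dominate the branch except possibly `x`. Then `∑ a ≤ γ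
≤ ∑ a + 1`, and weighing the subdivision of one edge `vx` against that of two edges `vx`, `vy`
contradicts either value.

`IsTree.nonempty_iso_pathGraph` then turns the degree bound into a path. The path values come from
an explicit dominating set (`dominationNumber_le_of_numbering`) and from closed neighbourhoods
having at most 3 vertices (`card_le_three_mul_dominationNumber`). -/

theorem dominationNumber_le {G : SimpleGraph V} {D : Finset V} (h : G.IsDominating D) :
    G.dominationNumber ≤ D.card :=
  Nat.sInf_le ⟨D, h, rfl⟩

theorem exists_isDominating_card_eq [Finite V] (G : SimpleGraph V) :
    ∃ D : Finset V, G.IsDominating D ∧ D.card = G.dominationNumber := by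
  cases nonempty_fintype V
  exact Nat.sInf_mem (s := {k : ℕ | ∃ D : Finset V, G.IsDominating D ∧ D.card = k})
    ⟨_, Finset.univ, fun v hv => absurd (Finset.mem_univ v) hv, rfl⟩

/-- Upper bounds at a branching vertex need only dominating sets that avoid all subdivision
vertices. -/
theorem dominationNumber_subdivide_le {G : SimpleGraph V} {F : Finset (Sym2 V)} {D : Finset V}
    (hV : ∀ v, v ∉ D → ∃ u ∈ D, G.Adj v u ∧ s(v, u) ∉ F)
    (hF : ∀ e ∈ F, ∃ v ∈ e, v ∈ D) : (G.subdivide F).dominationNumber ≤ D.card := by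
  classical
  have h : (G.subdivide F).IsDominating (D.map Function.Embedding.inl) := by
    rintro (v | ⟨e, he⟩) hv
    · obtain ⟨u, hu, ha⟩ := hV v (by simpa using hv)
      exact ⟨Sum.inl u, by simpa using hu, ha⟩
    · obtain ⟨u, hu, ha⟩ := hF e he
      exact ⟨Sum.inl u, by simpa using ha, hu⟩
  simpa using dominationNumber_le h

/-- A minimum dominating set of the graph with one subdivided edge: its trace `D` on the original
vertices, together with the number `c` of times the subdivision vertex is used. -/
theorem exists_of_subdivide_singleton [Finite V] (G : SimpleGraph V) (e : Sym2 V) :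
    ∃ (D : Finset V) (c : ℕ), D.card + c = (G.subdivide {e}).dominationNumber ∧
      (∀ u, u ∉ D → (∃ u' ∈ D, G.Adj u u' ∧ s(u, u') ≠ e) ∨ (u ∈ e ∧ c ≠ 0)) ∧
      (c ≠ 0 ∨ ∃ u ∈ e, u ∈ D) := by
  classical
  obtain ⟨D, hD, hc⟩ := (G.subdivide {e}).exists_isDominating_card_eq
  refine ⟨D.toLeft, D.toRight.card, by rw [Finset.card_toLeft_add_card_toRight, hc], ?_, ?_⟩
  · intro u hu
    obtain ⟨w | w, hw, ha⟩ := hD (Sum.inl u) (by simpa using hu)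
    · exact Or.inl ⟨w, by simpa using hw, ha.1, by simpa using ha.2⟩
    · refine Or.inr ⟨?_, ?_⟩
      · have : (w : Sym2 V) = e := Finset.mem_singleton.1 w.2
        rw [← this]; exact ha
      · exact Finset.card_ne_zero.2 ⟨w, by simpa using hw⟩
  · by_cases hin : Sum.inr ⟨e, by simp⟩ ∈ D
    · exact Or.inl (Finset.card_ne_zero.2 ⟨_, Finset.mem_toRight.2 hin⟩)
    · obtain ⟨w | w, hw, ha⟩ := hD _ hin
      · exact Or.inr ⟨w, ha, by simpa using hw⟩
      · exact ha.elim

/-- In an acyclic connected graph every vertex other than `v` is labelled by the neighbour of `v`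
through which it is reached. -/
theorem IsTree.exists_branch {T : SimpleGraph V} (hT : T.IsTree) (v : V) :
    ∃ f : V → V, (∀ u, u ≠ v → T.Adj v (f u)) ∧ (∀ x, T.Adj v x → f x = x) ∧
      ∀ u u', u ≠ v → u' ≠ v → T.Adj u u' → f u = f u' := by
  classical
  let H : SimpleGraph V := T.deleteEdges (T.incidenceSet v)
  have hH : ∀ u u', u ≠ v → u' ≠ v → T.Adj u u' → H.Adj u u' := by
    intro u u' hu hu' h
    simp only [H, deleteEdges_adj, incidenceSet]
    refine ⟨h, fun h' => ?_⟩
    rcases Sym2.mem_iff.1 h'.2 with h | h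
    · exact hu h.symm
    · exact hu' h.symm
  have hex : ∀ u, u ≠ v → ∃ x, T.Adj v x ∧ H.Reachable x u := by
    intro u hu
    obtain ⟨p⟩ := hT.connected.preconnected u v
    have key : ∀ (a b : V) (q : T.Walk a b), b = v → a ≠ v →
        ∃ x, T.Adj v x ∧ H.Reachable x a := by
      intro a b q
      induction q with
      | nil => intro h h'; exact absurd h h'
      | @cons a b' c h q ih =>
        intro hc ha
        by_cases hb : b' = v
        · subst hb
          exact ⟨a, h.symm, Reachable.refl _⟩
        · obtain ⟨x, hx, hr⟩ := ih hc hb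
          exact ⟨x, hx, hr.trans (hH _ _ hb ha h.symm).reachable⟩
    exact key u v p rfl hu
  -- The edge `vx` is a bridge: a path from `x` to `y` avoiding `v`, followed by the edge `yv`,
  -- would bypass it.
  have huniq : ∀ x y, T.Adj v x → T.Adj v y → H.Reachable x y → x = y := by
    intro x y hx hy hr
    by_contra hne
    have hb := isAcyclic_iff_forall_adj_isBridge.1 hT.isAcyclic hx
    rw [isBridge_iff] at hb
    refine hb ?_
    have h1 : H ≤ T.deleteEdges {s(v, x)} := by
      intro a b hab
      simp only [H, deleteEdges_adj] at hab
      rw [deleteEdges_adj, Set.mem_singleton_iff]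
      exact ⟨hab.1, fun h => hab.2 (h ▸ ⟨hx, Sym2.mem_mk_left _ _⟩)⟩
    have h2 : (T.deleteEdges {s(v, x)}).Adj v y := by
      rw [deleteEdges_adj, Set.mem_singleton_iff, Sym2.eq_iff]
      grind
    exact h2.reachable.trans (hr.symm.mono h1)
  choose! f hf using hex
  refine ⟨f, fun u hu => (hf u hu).1, fun x hx => ?_, fun u u' hu hu' h => ?_⟩
  · exact huniq _ _ (hf x hx.ne').1 hx (hf x hx.ne').2
  · exact huniq _ _ (hf u hu).1 (hf u' hu').1
      (((hf u hu).2.trans (hH _ _ hu hu' h).reachable).trans (hf u' hu').2.symm)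

end Basic

/-! ### Excluding vertices of degree at least three. -/

section Branch

variable {V : Type*}

/-- `D` lies in the branch labelled `x` at `v` and dominates all of it, except possibly `x`. -/
def NearDominatesBranch (T : SimpleGraph V) (v : V) (f : V → V) (x : V) (D : Finset V) : Prop :=
  (∀ u ∈ D, u ≠ v ∧ f u = x) ∧
    ∀ u, u ≠ v → f u = x → u ≠ x → u ∉ D → ∃ u' ∈ D, T.Adj u u'

/-- `D` lies in the branch labelled `x` at `v` and dominates all of it. -/
def DominatesBranch (T : SimpleGraph V) (v : V) (f : V → V) (x : V) (D : Finset V) : Prop :=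
  T.NearDominatesBranch v f x D ∧ (x ∉ D → ∃ u' ∈ D, T.Adj x u')

theorem exists_min_card {α : Type*} [Finite α] (P : Finset α → Prop) (h : ∃ D, P D) :
    ∃ D, P D ∧ ∀ D', P D' → D.card ≤ D'.card := by
  classical
  cases nonempty_fintype α
  obtain ⟨D, hD, hm⟩ := Finset.exists_min_image (Finset.univ.filter P) Finset.card
    (by obtain ⟨D, hD⟩ := h; exact ⟨D, by simpa using hD⟩)
  exact ⟨D, by simpa using hD, fun D' h' => hm D' (by simpa using h')⟩

/-- Each branch in `S` that costs more than its minimum adds one to the total. -/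
theorem sum_add_card_le_sum {α : Type*} {N S : Finset α} {a n : α → ℕ}
    (h : ∀ z ∈ N, a z ≤ n z) (hSN : S ⊆ N) (hS : ∀ z ∈ S, a z + 1 ≤ n z) :
    ∑ z ∈ N, a z + S.card ≤ ∑ z ∈ N, n z := by
  classical
  have : ∑ z ∈ N, (a z + if z ∈ S then 1 else 0) = ∑ z ∈ N, a z + S.card := by
    rw [Finset.sum_add_distrib, Finset.sum_ite_mem, Finset.inter_eq_right.2 hSN]
    simp
  rw [← this]
  refine Finset.sum_le_sum fun z hz => ?_
  split_ifs with hzS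
  · exact hS z hzS
  · exact h z hz

theorem exists_min_nearDominatesBranch [Finite V] (T : SimpleGraph V) (v : V) (f : V → V) (x : V) :
    ∃ D, T.NearDominatesBranch v f x D ∧
      ∀ D', T.NearDominatesBranch v f x D' → D.card ≤ D'.card := by
  classical
  cases nonempty_fintype V
  refine exists_min_card _ ⟨Finset.univ.filter fun u => u ≠ v ∧ f u = x, ?_, ?_⟩
  · intro u hu; simpa using hu
  · intro u hu hx _ h; exact absurd (by simpa using ⟨hu, hx⟩) h

/-- In a tree where subdividing one edge never increases the domination number and subdividing
two edges always does, all degrees are at most two. -/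
theorem IsTree.card_le_two_of_critical [Finite V] {T : SimpleGraph V} (hT : T.IsTree)
    (hA : ∀ e ∈ T.edgeSet, (T.subdivide {e}).dominationNumber ≤ T.dominationNumber)
    (hB : ∀ F : Finset (Sym2 V), (F : Set (Sym2 V)) ⊆ T.edgeSet → F.card = 2 →
      T.dominationNumber < (T.subdivide F).dominationNumber)
    (v : V) (N : Finset V) (hN : ∀ x, x ∈ N ↔ T.Adj v x) : N.card ≤ 2 := by
  classical
  by_contra! hcard
  obtain ⟨f, hf1, hf2, hf3⟩ := hT.exists_branch v
  have hfN : ∀ u, u ≠ v → f u ∈ N := fun u hu => (hN _).2 (hf1 u hu)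
  choose α hα hαmin using T.exists_min_nearDominatesBranch v f
  set a : V → ℕ := fun x => (α x).card with ha
  set γ := T.dominationNumber
  let piece : Finset V → V → Finset V := fun D z => (D.erase v).filter (f · = z)
  have hpiece : ∀ D z u, u ∈ piece D z ↔ u ≠ v ∧ u ∈ D ∧ f u = z := by
    intro D z u; simp [piece, and_assoc]
  have hsum : ∀ D : Finset V, (D.erase v).card = ∑ z ∈ N, (piece D z).card := fun D =>
    Finset.card_eq_sum_card_fiberwise fun u hu => hfN u (Finset.ne_of_mem_erase hu)
  -- A minimum dominating set after subdividing the edge `v x`.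
  have hA' : ∀ x ∈ N, ∃ (D : Finset V) (c : ℕ), D.card + c ≤ γ ∧
      (∀ z ∈ N, T.NearDominatesBranch v f z (piece D z)) ∧
      (v ∉ D → ∀ z ∈ N, z ≠ x → T.DominatesBranch v f z (piece D z)) ∧
      (c = 0 → T.DominatesBranch v f x (piece D x)) ∧
      (c ≠ 0 ∨ v ∈ D ∨ x ∈ D) := by
    intro x hxN
    have hx := (hN x).1 hxN
    obtain ⟨D, c, hc, h1, h2⟩ := T.exists_of_subdivide_singleton s(v, x)
    have hnear : ∀ z ∈ N, T.NearDominatesBranch v f z (piece D z) := by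
      intro z hz
      refine ⟨fun u hu => by rw [hpiece] at hu; exact ⟨hu.1, hu.2.2⟩, fun u hu hfu huz huD => ?_⟩
      rcases h1 u (fun h => huD ((hpiece _ _ _).2 ⟨hu, h, hfu⟩)) with ⟨u', hu', had, -⟩ | ⟨hmem, -⟩
      · have hu'v : u' ≠ v := by
          -- If the dominating vertex were `v`, then `u` would be a neighbour of `v`, hence the root
          -- of its own branch.
          rintro rfl
          exact huz ((hf2 u had.symm).symm.trans hfu)
        exact ⟨u', (hpiece _ _ _).2 ⟨hu'v, hu', (hf3 u u' hu hu'v had) ▸ hfu⟩, had⟩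
      · rcases Sym2.mem_iff.1 hmem with h | h
        · exact absurd h hu
        · exact absurd (h.trans ((hf2 x hx).symm.trans (h ▸ hfu))) huz
    have hdom : ∀ z ∈ N, (z ∉ D → ∃ u' ∈ D, T.Adj z u' ∧ u' ≠ v) →
        T.DominatesBranch v f z (piece D z) := by
      intro z hz h
      have hzv := (hN z).1 hz
      refine ⟨hnear z hz, fun hzD => ?_⟩
      obtain ⟨u', hu', had, hv⟩ := h fun h => hzD ((hpiece _ _ _).2 ⟨hzv.ne', h, hf2 z hzv⟩)
      exact ⟨u', (hpiece _ _ _).2 ⟨hv, hu', (hf3 z u' hzv.ne' hv had) ▸ hf2 z hzv⟩, had⟩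
    refine ⟨D, c, hc.le.trans (hA _ hx), hnear, fun hvD z hz hzx => hdom z hz fun hzD => ?_,
      fun hc0 => hdom x hxN fun hxD => ?_, ?_⟩
    · rcases h1 z hzD with ⟨u', hu', had, -⟩ | ⟨hmem, -⟩
      · exact ⟨u', hu', had, fun h => hvD (h ▸ hu')⟩
      · rcases Sym2.mem_iff.1 hmem with h | h
        · exact absurd h ((hN z).1 hz).ne'
        · exact absurd h hzx
    · rcases h1 x hxD with ⟨u', hu', had, hne⟩ | ⟨-, hc⟩
      · exact ⟨u', hu', had, fun h => hne (by rw [h, Sym2.eq_swap])⟩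
      · exact absurd hc0 hc
    · rcases h2 with h2 | ⟨u, hu, huD⟩
      · exact Or.inl h2
      · rcases Sym2.mem_iff.1 hu with rfl | rfl
        · exact Or.inr (Or.inl huD)
        · exact Or.inr (Or.inr huD)
  have hcardv : ∀ D : Finset V, v ∈ D → D.card = ∑ z ∈ N, (piece D z).card + 1 := fun D h => by
    rw [← hsum, Finset.card_erase_add_one h]
  have hcardv' : ∀ D : Finset V, v ∉ D → D.card = ∑ z ∈ N, (piece D z).card := fun D h => by
    rw [← hsum, Finset.erase_eq_of_notMem h]
  -- Subdividing two edges at `v`.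
  have hB' : ∀ x ∈ N, ∀ y ∈ N, x ≠ y → γ < (T.subdivide {s(v, x), s(v, y)}).dominationNumber := by
    intro x hx y hy hxy
    refine hB _ ?_ ?_
    · intro e he
      simp only [Finset.coe_insert, Finset.coe_singleton, Set.mem_insert_iff,
        Set.mem_singleton_iff] at he
      rcases he with rfl | rfl
      · exact (hN x).1 hx
      · exact (hN y).1 hy
    · rw [Finset.card_pair]
      intro h
      rw [Sym2.eq_iff] at h
      have := ((hN y).1 hy).ne
      grind
  have hnotF : ∀ x y u u', u ≠ v → u' ≠ v → s(u, u') ∉ ({s(v, x), s(v, y)} : Finset (Sym2 V)) := by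
    intro x y u u' hu hu' h
    simp only [Finset.mem_insert, Finset.mem_singleton, Sym2.eq_iff] at h
    grind
  -- If `γ = ∑ a`, an optimal set for `vx` subdivided can afford neither `v` nor the subdivision
  -- vertex, so it contains `x` and is minimum on every branch.
  by_cases hcase : γ ≤ ∑ z ∈ N, a z
  · have hc : ∀ x ∈ N, ∃ D, T.NearDominatesBranch v f x D ∧ x ∈ D ∧ D.card ≤ a x := by
      intro x hx
      obtain ⟨D, c, hc, hnear, hdom, hdomx, hex⟩ := hA' x hx
      have hle : ∀ z ∈ N, a z ≤ (piece D z).card := fun z hz => hαmin _ _ (hnear z hz)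
      have hsle := Finset.sum_le_sum hle
      have hvD : v ∉ D := fun h => by have := hcardv D h; omega
      have hcD := hcardv' D hvD
      refine ⟨piece D x, hnear x hx, ?_, ?_⟩
      · refine (hpiece _ _ _).2 ⟨((hN x).1 hx).ne', ?_, hf2 x ((hN x).1 hx)⟩
        rcases hex with h | h | h
        · omega
        · exact absurd h hvD
        · exact h
      · by_contra! hlt
        have := sum_add_card_le_sum hle (Finset.singleton_subset_iff.2 hx)
          (fun z hz => by rw [Finset.mem_singleton.1 hz]; exact hlt)
        rw [Finset.card_singleton] at this
        omega
    choose! χ hχ hχmem hχle using hc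
    -- With `vx` and `vy` subdivided, `x` and `y` dominate the new vertices and the third neighbour
    -- `w` dominates `v`.
    obtain ⟨x, hx, y, hy, w, hw, hxy, hxw, hyw⟩ := Finset.two_lt_card.1 hcard
    have h1 : γ ≥ ∑ z ∈ N, a z := by
      obtain ⟨D, c, hc, hnear, -⟩ := hA' x hx
      have hle : ∀ z ∈ N, a z ≤ (piece D z).card := fun z hz => hαmin _ _ (hnear z hz)
      have := Finset.sum_le_sum hle
      by_cases h : v ∈ D
      · have := hcardv D h; omega
      · have := hcardv' D h; omega
    have h2 := hB' x hx y hy hxy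
    have h3 : (T.subdivide {s(v, x), s(v, y)}).dominationNumber ≤ (N.biUnion χ).card := by
      have hmem : ∀ z ∈ N, z ∈ N.biUnion χ := fun z hz => Finset.mem_biUnion.2 ⟨z, hz, hχmem z hz⟩
      refine dominationNumber_subdivide_le ?_ ?_
      · intro u hu
        by_cases huv : u = v
        · subst huv
          refine ⟨w, hmem w hw, (hN w).1 hw, ?_⟩
          simp only [Finset.mem_insert, Finset.mem_singleton, Sym2.eq_iff]
          grind
        · have hfu := hfN u huv
          obtain ⟨u', hu', had⟩ := (hχ _ hfu).2 u huv rfl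
            (fun h => hu (h ▸ hmem _ hfu))
            (fun h => hu (Finset.mem_biUnion.2 ⟨_, hfu, h⟩))
          exact ⟨u', Finset.mem_biUnion.2 ⟨_, hfu, hu'⟩, had,
            hnotF _ _ _ _ huv ((hχ _ hfu).1 u' hu').1⟩
      · intro e he
        simp only [Finset.mem_insert, Finset.mem_singleton] at he
        rcases he with rfl | rfl
        · exact ⟨x, Sym2.mem_mk_right _ _, hmem x hx⟩
        · exact ⟨y, Sym2.mem_mk_right _ _, hmem y hy⟩
    have h4 : (N.biUnion χ).card ≤ ∑ z ∈ N, a z :=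
      Finset.card_biUnion_le.trans (Finset.sum_le_sum hχle)
    omega
  · have hγ : γ ≤ ∑ z ∈ N, a z + 1 := by
      have h1 : T.IsDominating (insert v (N.biUnion α)) := by
        intro u hu
        rw [Finset.mem_insert, not_or] at hu
        by_cases huN : u ∈ N
        · exact ⟨v, Finset.mem_insert_self _ _, ((hN u).1 huN).symm⟩
        · have hfu := hfN u hu.1
          obtain ⟨u', hu', had⟩ := (hα (f u)).2 u hu.1 rfl (fun h => huN (h ▸ hfu))
            (fun h => hu.2 (Finset.mem_biUnion.2 ⟨_, hfu, h⟩))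
          exact ⟨u', Finset.mem_insert_of_mem (Finset.mem_biUnion.2 ⟨_, hfu, hu'⟩), had⟩
      have h2 := dominationNumber_le h1
      have h3 := Finset.card_insert_le v (N.biUnion α)
      have h4 : (N.biUnion α).card ≤ ∑ z ∈ N, a z := Finset.card_biUnion_le
      omega
    -- Now `γ = ∑ a + 1`. Two branches fully dominated at minimum cost would, together with `v`,
    -- dominate `T` with both their edges subdivided, at cost `γ`. So at most one branch has `P`,
    -- and at least two lack it.
    let P : V → Prop := fun x => ∃ D, T.DominatesBranch v f x D ∧ D.card ≤ a x
    have hP : (N.filter P).card ≤ 1 := by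
      by_contra! hlt
      obtain ⟨x, hx, y, hy, hxy⟩ := Finset.one_lt_card.1 hlt
      obtain ⟨hxN, X, hX, hXa⟩ := Finset.mem_filter.1 hx
      obtain ⟨hyN, Y, hY, hYa⟩ := Finset.mem_filter.1 hy
      have h2 := hB' x hxN y hyN hxy
      let g : V → Finset V := fun z => if z = x then X else if z = y then Y else α z
      have hg : ∀ z, T.NearDominatesBranch v f z (g z) := by
        intro z
        by_cases hzx : z = x
        · subst hzx; simpa [g] using hX.1
        by_cases hzy : z = y
        · subst hzy; simpa [g, hzx] using hY.1
        · simpa [g, hzx, hzy] using hα z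
      have hg' : ∀ z, z = x ∨ z = y → T.DominatesBranch v f z (g z) := by
        rintro z (rfl | rfl)
        · simpa [g] using hX
        · simpa [g, hxy.symm] using hY
      have hga : ∀ z ∈ N, (g z).card ≤ a z := by
        intro z _
        by_cases hzx : z = x
        · subst hzx; simpa [g] using hXa
        by_cases hzy : z = y
        · subst hzy; simpa [g, hzx] using hYa
        · simp [g, hzx, hzy, ha]
      have h3 : (T.subdivide {s(v, x), s(v, y)}).dominationNumber ≤
          (insert v (N.biUnion g)).card := by
        refine dominationNumber_subdivide_le ?_ ?_
        · intro u hu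
          rw [Finset.mem_insert, not_or] at hu
          have hfu := hfN u hu.1
          have hug : u ∉ g (f u) := fun h => hu.2 (Finset.mem_biUnion.2 ⟨_, hfu, h⟩)
          have key : (∃ u' ∈ g (f u), T.Adj u u') → ∃ u' ∈ insert v (N.biUnion g),
              T.Adj u u' ∧ s(u, u') ∉ ({s(v, x), s(v, y)} : Finset (Sym2 V)) := by
            rintro ⟨u', hu', had⟩
            exact ⟨u', Finset.mem_insert_of_mem (Finset.mem_biUnion.2 ⟨_, hfu, hu'⟩), had,
              hnotF _ _ _ _ hu.1 ((hg _).1 u' hu').1⟩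
          by_cases huN : u ∈ N
          · have hu2 := hf2 u ((hN u).1 huN)
            by_cases huxy : u = x ∨ u = y
            · refine key ?_
              rw [hu2] at hug ⊢
              exact (hg' u huxy).2 hug
            · refine ⟨v, Finset.mem_insert_self _ _, ((hN u).1 huN).symm, ?_⟩
              simp only [Finset.mem_insert, Finset.mem_singleton, Sym2.eq_iff]
              grind
          · exact key ((hg (f u)).2 u hu.1 rfl (fun h => huN (h ▸ hfu)) hug)
        · intro e he
          simp only [Finset.mem_insert, Finset.mem_singleton] at he
          rcases he with rfl | rfl
          · exact ⟨v, Sym2.mem_mk_left _ _, Finset.mem_insert_self _ _⟩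
          · exact ⟨v, Sym2.mem_mk_left _ _, Finset.mem_insert_self _ _⟩
      have h4 := Finset.card_insert_le v (N.biUnion g)
      have h5 : (N.biUnion g).card ≤ ∑ z ∈ N, a z :=
        Finset.card_biUnion_le.trans (Finset.sum_le_sum hga)
      omega
    have hQ : 1 < (N.filter fun x => ¬ P x).card := by
      have := Finset.card_filter_add_card_filter_not (s := N) P
      omega
    obtain ⟨x, hx, y, hy, hxy⟩ := Finset.one_lt_card.1 hQ
    obtain ⟨hxN, hxP⟩ := Finset.mem_filter.1 hx
    obtain ⟨hyN, hyP⟩ := Finset.mem_filter.1 hy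
    have hlow : ∀ z D, ¬ P z → T.DominatesBranch v f z D → a z + 1 ≤ D.card := by
      intro z D hz hD
      by_contra! h
      exact hz ⟨D, hD, by omega⟩
    -- The excess over `∑ a` is at least 2. Including `v` costs 1, and excluding it costs 1 on
    -- branch `y`; using the subdivision vertex costs 1, and not using it costs 1 on branch `x`.
    obtain ⟨D, c, hc, hnear, hdom, hdomx, hex⟩ := hA' x hxN
    have hle : ∀ z ∈ N, a z ≤ (piece D z).card := fun z hz => hαmin _ _ (hnear z hz)
    have hsle := Finset.sum_le_sum hle
    have hX := fun h : c = 0 => sum_add_card_le_sum hle (Finset.singleton_subset_iff.2 hxN)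
      (fun z hz => by rw [Finset.mem_singleton.1 hz]; exact hlow x _ hxP (hdomx h))
    have hY := fun h : v ∉ D => sum_add_card_le_sum hle (Finset.singleton_subset_iff.2 hyN)
      (fun z hz => by
        rw [Finset.mem_singleton.1 hz]; exact hlow y _ hyP (hdom h y hyN hxy.symm))
    rw [Finset.card_singleton] at hX hY
    by_cases hvD : v ∈ D
    · have h1 := hcardv D hvD
      by_cases hc0 : c = 0
      · have := hX hc0; omega
      · omega
    · have h1 := hcardv' D hvD
      by_cases hc0 : c = 0
      · have := sum_add_card_le_sum (S := {x, y}) hle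
          (by intro z hz; rcases Finset.mem_insert.1 hz with rfl | hz
              · exact hxN
              · rwa [Finset.mem_singleton.1 hz])
          (by intro z hz; rcases Finset.mem_insert.1 hz with rfl | hz
              · exact hlow _ _ hxP (hdomx hc0)
              · rw [Finset.mem_singleton.1 hz]; exact hlow y _ hyP (hdom hvD y hyN hxy.symm))
        rw [Finset.card_pair hxy] at this
        omega
      · have := hY hvD; omega

end Branch

/-! ### Domination bounds for path-like graphs, and recognition of paths. -/

section Path

variable {V : Type*}

/-- If the vertices can be numbered `0, …, N - 1` with consecutive vertices adjacent, then
`⌈N / 3⌉` vertices dominate. -/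
theorem dominationNumber_le_of_numbering [Finite V] (G : SimpleGraph V) (q : V → ℕ) (N : ℕ)
    (hinj : Function.Injective q) (hlt : ∀ v, q v < N) (hsurj : ∀ j < N, ∃ v, q v = j)
    (hadj : ∀ u v, q v = q u + 1 → G.Adj u v) : G.dominationNumber ≤ (N + 2) / 3 := by
  classical
  cases nonempty_fintype V
  -- The middle of each block of three, plus the last vertex when it is alone in its block.
  let D : Finset V := Finset.univ.filter fun v => q v % 3 = 1 ∨ (q v + 1 = N ∧ q v % 3 = 0)
  have hD : G.IsDominating D := by
    intro v hv
    have hv' : ¬ (q v % 3 = 1 ∨ (q v + 1 = N ∧ q v % 3 = 0)) := by simpa [D] using hv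
    have := hlt v
    by_cases h0 : q v % 3 = 0
    · obtain ⟨w, hw⟩ := hsurj (q v + 1) (by omega)
      exact ⟨w, by simp [D]; omega, hadj _ _ hw⟩
    · obtain ⟨w, hw⟩ := hsurj (q v - 1) (by omega)
      exact ⟨w, by simp [D]; omega, (hadj _ _ (by omega)).symm⟩
  refine (dominationNumber_le hD).trans ?_
  rw [← Finset.card_range ((N + 2) / 3)]
  refine Finset.card_le_card_of_injOn (fun v => q v / 3) ?_ ?_
  · intro v hv
    have hv' : q v % 3 = 1 ∨ (q v + 1 = N ∧ q v % 3 = 0) := by simpa [D] using hv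
    have := hlt v
    simp only [Finset.coe_range, Set.mem_Iio]
    omega
  · intro v hv w hw h
    have hv' : q v % 3 = 1 ∨ (q v + 1 = N ∧ q v % 3 = 0) := by simpa [D] using hv
    have hw' : q w % 3 = 1 ∨ (q w + 1 = N ∧ q w % 3 = 0) := by simpa [D] using hw
    have := hlt v
    have := hlt w
    simp only at h
    exact hinj (by omega)

theorem card_le_three_mul_dominationNumber [Finite V] (G : SimpleGraph V)
    (h : ∀ v, ∃ a b, ∀ w, G.Adj v w → w = a ∨ w = b) :
    Nat.card V ≤ 3 * G.dominationNumber := by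
  classical
  cases nonempty_fintype V
  obtain ⟨D, hD, hc⟩ := G.exists_isDominating_card_eq
  choose a b hab using h
  have huniv : (Finset.univ : Finset V) ⊆ D.biUnion fun v => {v, a v, b v} := by
    intro v _
    rw [Finset.mem_biUnion]
    by_cases hv : v ∈ D
    · exact ⟨v, hv, by simp⟩
    · obtain ⟨u, hu, ha⟩ := hD v hv
      exact ⟨u, hu, by have := hab u v ha.symm; simp; tauto⟩
  have h1 := (Finset.card_le_card huniv).trans
    (Finset.card_biUnion_le_card_mul D _ 3 fun v _ => Finset.card_le_three)
  rw [Finset.card_univ, ← Nat.card_eq_fintype_card] at h1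
  omega

/-- Subdivision preserves the degree bound 2: each neighbour is replaced by at most one new vertex.
-/
theorem card_add_card_le_three_mul_dominationNumber_subdivide [Finite V] (G : SimpleGraph V)
    (h : ∀ v, ∃ a b, ∀ w, G.Adj v w → w = a ∨ w = b) (F : Finset (Sym2 V))
    (hF : (F : Set (Sym2 V)) ⊆ G.edgeSet) :
    Nat.card V + F.card ≤ 3 * (G.subdivide F).dominationNumber := by
  classical
  have : Nat.card (V ⊕ F) = Nat.card V + F.card := by simp [Nat.card_sum]
  rw [← this]
  refine card_le_three_mul_dominationNumber _ ?_
  rintro (v | ⟨e, he⟩)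
  · obtain ⟨a, b, hab⟩ := h v
    let g : V → V ⊕ F := fun x => if hx : s(v, x) ∈ F then Sum.inr ⟨s(v, x), hx⟩ else Sum.inl x
    refine ⟨g a, g b, ?_⟩
    have key : ∀ w, (G.subdivide F).Adj (Sum.inl v) w → ∃ x, G.Adj v x ∧ w = g x := by
      rintro (u | ⟨e, he⟩) hw
      · exact ⟨u, hw.1, by simp [g, hw.2]⟩
      · obtain ⟨x, rfl⟩ : ∃ x, e = s(v, x) := hw
        exact ⟨x, hF he, by simp [g, Finset.mem_coe.1 he]⟩
    intro w hw
    obtain ⟨x, hx, rfl⟩ := key w hw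
    rcases hab x hx with rfl | rfl
    · exact Or.inl rfl
    · exact Or.inr rfl
  · induction e with
    | h x y =>
      refine ⟨Sum.inl x, Sum.inl y, ?_⟩
      rintro (u | u) hw
      · rcases Sym2.mem_iff.1 (show u ∈ s(x, y) from hw) with rfl | rfl
        · exact Or.inl rfl
        · exact Or.inr rfl
      · exact hw.elim

/-- A tree with all degrees at most two is a path. -/
theorem IsTree.nonempty_iso_pathGraph [Finite V] [Nontrivial V] {T : SimpleGraph V}
    (hT : T.IsTree)
    (hdeg : ∀ (v : V) (N : Finset V), (∀ x, x ∈ N ↔ T.Adj v x) → N.card ≤ 2) :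
    Nonempty (T ≃g pathGraph (Nat.card V)) := by
  classical
  cases nonempty_fintype V
  obtain ⟨r, hr⟩ := hT.exists_vert_degree_one_of_nontrivial
  obtain ⟨s, hs, hs'⟩ := degree_eq_one_iff_existsUnique_adj.1 hr
  have hthree : ∀ v x y z, T.Adj v x → T.Adj v y → T.Adj v z → x ≠ y → z ≠ x → z ≠ y → False := by
    intro v x y z hx hy hz hxy hzx hzy
    have h1 := hdeg v (T.neighborFinset v) (by simp)
    have h2 : ({x, y, z} : Finset V) ⊆ T.neighborFinset v := by
      intro w hw
      simp only [Finset.mem_insert, Finset.mem_singleton] at hw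
      rw [mem_neighborFinset]
      rcases hw with rfl | rfl | rfl <;> assumption
    have h3 := Finset.card_le_card h2
    rw [Finset.card_eq_three.2 ⟨x, y, z, hxy, hzx.symm, hzy.symm, rfl⟩] at h3
    omega
  set p : V → ℕ := fun v => T.dist r v with hp
  have hpred : ∀ v k, p v = k + 1 → ∃ u, T.Adj u v ∧ p u = k := by
    intro v k hk
    obtain ⟨w, hw⟩ := hT.connected.exists_walk_length_eq_dist v r
    cases w with
    | nil => simp [hp] at hk
    | @cons _ b _ h w' =>
      refine ⟨b, h.symm, ?_⟩
      have h1 : T.dist b r ≤ w'.length := dist_le w'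
      have h2 := h.diff_dist_adj (u := r)
      rw [Walk.length_cons] at hw
      have := T.dist_comm (u := v) (v := r)
      have := T.dist_comm (u := b) (v := r)
      simp only [hp] at hk ⊢
      omega
  have hp0 : ∀ v, p v = 0 → v = r := fun v h => (hT.connected.dist_eq_zero_iff.1 h).symm
  -- Two vertices at one distance from the leaf `r` share a predecessor, which is either `r` itself
  -- or has a predecessor as third neighbour.
  have hinj' : ∀ k u v, p u = k → p v = k → u = v := by
    intro k
    induction k with
    | zero => intro u v hu hv; rw [hp0 u hu, hp0 v hv]
    | succ k ih =>
      intro u v hu hv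
      obtain ⟨x, hx, hxk⟩ := hpred u k hu
      obtain ⟨y, hy, hyk⟩ := hpred v k hv
      obtain rfl := ih x y hxk hyk
      by_contra hne
      cases k with
      | zero =>
        obtain rfl := hp0 x hxk
        exact hne ((hs' u hx).trans (hs' v hy).symm)
      | succ k =>
        obtain ⟨z, hz, hzk⟩ := hpred x k hxk
        exact hthree x u v z hx hy hz.symm hne (by rintro rfl; omega) (by rintro rfl; omega)
  have hinj : Function.Injective p := fun u v h => hinj' _ u v h rfl
  have hdown : ∀ k v, p v = k → ∀ j ≤ k, ∃ u, p u = j := by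
    intro k
    induction k with
    | zero => intro v hv j hj; exact ⟨v, by omega⟩
    | succ k ih =>
      intro v hv j hj
      rcases Nat.lt_or_ge k j with h | h
      · exact ⟨v, by omega⟩
      · obtain ⟨u, -, hu⟩ := hpred v k hv
        exact ih u hu j h
  have hlt : ∀ v, p v < Nat.card V := by
    intro v
    rw [Nat.card_eq_fintype_card, ← Finset.card_univ]
    have h1 : Finset.range (p v + 1) ⊆ Finset.univ.image p := by
      intro j hj
      obtain ⟨u, hu⟩ := hdown _ v rfl j (by have := Finset.mem_range.1 hj; omega)
      exact Finset.mem_image.2 ⟨u, Finset.mem_univ _, hu⟩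
    have h2 := (Finset.card_le_card h1).trans Finset.card_image_le
    rw [Finset.card_range] at h2
    omega
  let φ : V → Fin (Nat.card V) := fun v => ⟨p v, hlt v⟩
  have hφ : Function.Bijective φ := by
    rw [Fintype.bijective_iff_injective_and_card]
    exact ⟨fun u v h => hinj (Fin.mk.inj_iff.1 h), by simp⟩
  have hsucc : ∀ u v, p u + 1 = p v → T.Adj u v := by
    intro u v h
    obtain ⟨w, hw, hwk⟩ := hpred v (p u) h.symm
    exact hinj hwk ▸ hw
  refine ⟨⟨Equiv.ofBijective φ hφ, ?_⟩⟩
  intro u v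
  rw [pathGraph_adj]
  simp only [Equiv.ofBijective_apply, φ]
  refine ⟨fun h => h.elim (hsucc u v) fun h => (hsucc v u h).symm, fun h => ?_⟩
  have h1 := h.diff_dist_adj (u := r)
  have h2 : p u ≠ p v := fun h' => h.ne (hinj h')
  simp only [hp] at h2 ⊢
  omega

end Path

/-! ### Subdivided paths and the main equivalence. -/

section PathSubdivision

variable {V : Type*}

theorem Iso.exists_pathGraph_val_eq {T : SimpleGraph V} {n : ℕ} (φ : T ≃g pathGraph n) {j : ℕ}
    (hj : j < n) : ∃ v, (φ v : ℕ) = j :=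
  ⟨φ.symm ⟨j, hj⟩, by simp⟩

theorem Iso.pathGraph_adj_iff {T : SimpleGraph V} {n : ℕ} (φ : T ≃g pathGraph n) (u v : V) :
    T.Adj u v ↔ (φ u : ℕ) + 1 = φ v ∨ (φ v : ℕ) + 1 = φ u := by
  rw [← φ.map_adj_iff, pathGraph_adj]

theorem Iso.pathGraph_val_inj {T : SimpleGraph V} {n : ℕ} (φ : T ≃g pathGraph n) {u v : V}
    (h : (φ u : ℕ) = φ v) : u = v :=
  φ.injective (Fin.ext h)

theorem Iso.pathGraph_adj_eq_or_eq {T : SimpleGraph V} {n : ℕ} (φ : T ≃g pathGraph n) (v : V) :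
    ∃ a b, ∀ w, T.Adj v w → w = a ∨ w = b := by
  classical
  refine ⟨if h : ∃ a, (φ v : ℕ) + 1 = φ a then h.choose else v,
    if h : ∃ b, (φ b : ℕ) + 1 = φ v then h.choose else v, fun w hw => ?_⟩
  rcases (φ.pathGraph_adj_iff v w).1 hw with h | h
  · left
    have hex : ∃ a, (φ v : ℕ) + 1 = φ a := ⟨w, h⟩
    rw [dif_pos hex]
    exact φ.pathGraph_val_inj (h.symm.trans hex.choose_spec)
  · right
    have hex : ∃ b, (φ b : ℕ) + 1 = φ v := ⟨w, h⟩
    rw [dif_pos hex]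
    exact φ.pathGraph_val_inj (by have := hex.choose_spec; omega)

theorem Iso.nat_card_of_pathGraph {T : SimpleGraph V} {n : ℕ} (φ : T ≃g pathGraph n) :
    Nat.card V = n := by
  rw [Nat.card_congr φ.toEquiv, Nat.card_fin]

variable [Finite V] {T : SimpleGraph V} {n : ℕ}

theorem Iso.dominationNumber_le_of_pathGraph (φ : T ≃g pathGraph n) :
    T.dominationNumber ≤ (n + 2) / 3 :=
  T.dominationNumber_le_of_numbering (fun v => φ v) n (fun _ _ h => φ.pathGraph_val_inj h)
    (fun v => (φ v).2) (fun _ hj => φ.exists_pathGraph_val_eq hj)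
    fun u v h => (φ.pathGraph_adj_iff u v).2 (Or.inl h.symm)

/-- The set defining `sd` admits `k = 0`, and `T.subdivide ∅` lives on a different vertex type from
`T`, so this case needs its own bound. -/
theorem Iso.dominationNumber_subdivide_empty_le (φ : T ≃g pathGraph n) :
    (T.subdivide ∅).dominationNumber ≤ (n + 2) / 3 := by
  refine dominationNumber_le_of_numbering _
    (Sum.elim (fun v => (φ v : ℕ)) fun e => (Finset.notMem_empty _ e.2).elim) n ?_ ?_ ?_ ?_
  · rintro (u | ⟨e, he⟩) (v | ⟨f, hf⟩) h
    · exact congrArg Sum.inl (φ.pathGraph_val_inj h)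
    all_goals exact absurd ‹_ ∈ (∅ : Finset (Sym2 V))› (Finset.notMem_empty _)
  · rintro (u | ⟨e, he⟩)
    · exact (φ u).2
    · simp at he
  · intro j hj
    obtain ⟨v, hv⟩ := φ.exists_pathGraph_val_eq hj
    exact ⟨Sum.inl v, hv⟩
  · rintro (u | ⟨e, he⟩) (v | ⟨f, hf⟩) h
    · exact ⟨(φ.pathGraph_adj_iff u v).2 (Or.inl h.symm), Finset.notMem_empty _⟩
    all_goals exact absurd ‹_ ∈ (∅ : Finset (Sym2 V))› (Finset.notMem_empty _)

theorem Iso.dominationNumber_subdivide_singleton_le (φ : T ≃g pathGraph n) {x y : V}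
    (hxy : (φ x : ℕ) + 1 = φ y) :
    (T.subdivide {s(x, y)}).dominationNumber ≤ (n + 3) / 3 := by
  have hmem : ∀ u v, s(u, v) ∈ ({s(x, y)} : Finset (Sym2 V)) →
      (φ u : ℕ) = φ x ∧ (φ v : ℕ) = φ y ∨ (φ u : ℕ) = φ y ∧ (φ v : ℕ) = φ x := by
    intro u v h
    rw [Finset.mem_singleton, Sym2.eq_iff] at h
    rcases h with ⟨rfl, rfl⟩ | ⟨rfl, rfl⟩ <;> simp
  -- The new vertex takes the position after `x`; everything beyond `x` shifts by one.
  refine dominationNumber_le_of_numbering _ (Sum.elim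
    (fun v => if (φ v : ℕ) ≤ φ x then (φ v : ℕ) else φ v + 1) fun _ => φ x + 1) (n + 1) ?_ ?_ ?_ ?_
  · rintro (u | ⟨e, he⟩) (v | ⟨f, hf⟩) h
    · refine congrArg Sum.inl (φ.pathGraph_val_inj ?_)
      simp only [Sum.elim_inl] at h
      split_ifs at h <;> omega
    · simp only [Sum.elim_inl, Sum.elim_inr] at h
      split_ifs at h <;> omega
    · simp only [Sum.elim_inl, Sum.elim_inr] at h
      split_ifs at h <;> omega
    · rw [Finset.mem_singleton] at he hf
      subst he hf
      rfl
  · rintro (u | e)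
    · have := (φ u).2
      simp only [Sum.elim_inl]
      split_ifs <;> omega
    · have := (φ x).2
      simp only [Sum.elim_inr]
      omega
  · intro j hj
    rcases lt_trichotomy j (φ x + 1) with h | h | h
    · obtain ⟨v, hv⟩ := φ.exists_pathGraph_val_eq (j := j) (by have := (φ x).2; omega)
      exact ⟨Sum.inl v, by simp only [Sum.elim_inl]; split_ifs <;> omega⟩
    · exact ⟨Sum.inr ⟨s(x, y), by simp⟩, h.symm⟩
    · obtain ⟨v, hv⟩ := φ.exists_pathGraph_val_eq (j := j - 1) (by omega)
      exact ⟨Sum.inl v, by simp only [Sum.elim_inl]; split_ifs <;> omega⟩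
  · rintro (u | ⟨e, he⟩) (v | ⟨f, hf⟩) h
    · simp only [Sum.elim_inl] at h
      refine ⟨(φ.pathGraph_adj_iff u v).2 ?_, fun hF => ?_⟩
      · split_ifs at h <;> omega
      · have := hmem _ _ hF
        split_ifs at h <;> omega
    · rw [Finset.mem_singleton] at hf
      subst hf
      simp only [Sum.elim_inl, Sum.elim_inr] at h
      obtain rfl : u = x := φ.pathGraph_val_inj (by split_ifs at h <;> omega)
      exact Sym2.mem_mk_left _ _
    · rw [Finset.mem_singleton] at he
      subst he
      simp only [Sum.elim_inl, Sum.elim_inr] at h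
      obtain rfl : v = y := φ.pathGraph_val_inj (by split_ifs at h <;> omega)
      exact Sym2.mem_mk_right _ _
    · simp at h

/-- Subdividing the first two edges of a path. -/
theorem Iso.dominationNumber_subdivide_pair_le (φ : T ≃g pathGraph n) {x y z : V}
    (hx : (φ x : ℕ) = 0) (hy : (φ y : ℕ) = 1) (hz : (φ z : ℕ) = 2) [DecidableEq (Sym2 V)] :
    (T.subdivide {s(x, y), s(y, z)}).dominationNumber ≤ (n + 4) / 3 := by
  have hxmem : x ∈ s(x, y) := Sym2.mem_mk_left _ _
  have hxnot : x ∉ s(y, z) := by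
    intro h
    rcases Sym2.mem_iff.1 h with rfl | rfl <;> omega
  have hmem : ∀ u v, s(u, v) ∈ ({s(x, y), s(y, z)} : Finset (Sym2 V)) →
      (φ u : ℕ) + φ v = 1 ∨ (φ u : ℕ) ≤ 2 ∧ (φ v : ℕ) ≤ 2 := by
    intro u v h
    simp only [Finset.mem_insert, Finset.mem_singleton, Sym2.eq_iff] at h
    rcases h with (⟨rfl, rfl⟩ | ⟨rfl, rfl⟩) | (⟨rfl, rfl⟩ | ⟨rfl, rfl⟩) <;> omega
  classical
  -- The order is `x`, new, `y`, new, `z`, …: positions 0 and 1 double, later ones shift by 2.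
  refine dominationNumber_le_of_numbering _ (Sum.elim
    (fun v => if (φ v : ℕ) ≤ 1 then 2 * (φ v : ℕ) else φ v + 2)
    fun e : ({s(x, y), s(y, z)} : Finset (Sym2 V)) =>
      if x ∈ (e : Sym2 V) then 1 else 3) (n + 2) ?_ ?_ ?_ ?_
  · rintro (u | ⟨e, he⟩) (v | ⟨f, hf⟩) h
    · refine congrArg Sum.inl (φ.pathGraph_val_inj ?_)
      simp only [Sum.elim_inl] at h
      split_ifs at h <;> omega
    · simp only [Sum.elim_inl, Sum.elim_inr] at h
      split_ifs at h <;> omega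
    · simp only [Sum.elim_inl, Sum.elim_inr] at h
      split_ifs at h <;> omega
    · simp only [Finset.mem_insert, Finset.mem_singleton] at he hf
      rcases he with rfl | rfl <;> rcases hf with rfl | rfl <;> simp [hxnot] at h ⊢
  · have := (φ z).2
    rintro (u | e)
    · have := (φ u).2
      simp only [Sum.elim_inl]
      split_ifs <;> omega
    · simp only [Sum.elim_inr]
      split_ifs <;> omega
  · intro j hj
    have h5 : j = 0 ∨ j = 1 ∨ j = 2 ∨ j = 3 ∨ 4 ≤ j := by omega
    rcases h5 with rfl | rfl | rfl | rfl | h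
    · exact ⟨Sum.inl x, by simp [hx]⟩
    · exact ⟨Sum.inr ⟨s(x, y), by simp⟩, by simp⟩
    · exact ⟨Sum.inl y, by simp [hy]⟩
    · exact ⟨Sum.inr ⟨s(y, z), by simp⟩, by simp only [Sum.elim_inr, if_neg hxnot]⟩
    · obtain ⟨v, hv⟩ := φ.exists_pathGraph_val_eq (j := j - 2) (by omega)
      exact ⟨Sum.inl v, by simp only [Sum.elim_inl]; split_ifs <;> omega⟩
  · rintro (u | ⟨e, he⟩) (v | ⟨f, hf⟩) h
    · simp only [Sum.elim_inl] at h
      refine ⟨(φ.pathGraph_adj_iff u v).2 ?_, fun hF => ?_⟩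
      · split_ifs at h <;> omega
      · have := hmem _ _ hF
        split_ifs at h <;> omega
    · simp only [Sum.elim_inl, Sum.elim_inr] at h
      simp only [Finset.mem_insert, Finset.mem_singleton] at hf
      rcases hf with rfl | rfl
      · rw [if_pos hxmem] at h
        obtain rfl : u = x := φ.pathGraph_val_inj (by split_ifs at h <;> omega)
        exact Sym2.mem_mk_left _ _
      · rw [if_neg hxnot] at h
        obtain rfl : u = y := φ.pathGraph_val_inj (by split_ifs at h <;> omega)
        exact Sym2.mem_mk_left _ _
    · simp only [Sum.elim_inl, Sum.elim_inr] at h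
      simp only [Finset.mem_insert, Finset.mem_singleton] at he
      rcases he with rfl | rfl
      · rw [if_pos hxmem] at h
        obtain rfl : v = y := φ.pathGraph_val_inj (by split_ifs at h <;> omega)
        exact Sym2.mem_mk_right _ _
      · rw [if_neg hxnot] at h
        obtain rfl : v = z := φ.pathGraph_val_inj (by split_ifs at h <;> omega)
        exact Sym2.mem_mk_right _ _
    · simp only [Sum.elim_inr] at h
      split_ifs at h <;> omega

theorem Iso.dominationNumber_subdivide_le_of_mem_edgeSet (φ : T ≃g pathGraph n) {e : Sym2 V}
    (he : e ∈ T.edgeSet) : (T.subdivide {e}).dominationNumber ≤ (n + 3) / 3 := by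
  induction e with
  | h x y =>
    rcases (φ.pathGraph_adj_iff x y).1 he with h | h
    · exact φ.dominationNumber_subdivide_singleton_le h
    · rw [Sym2.eq_swap]
      exact φ.dominationNumber_subdivide_singleton_le h

theorem Iso.exists_card_eq_two_of_pathGraph (φ : T ≃g pathGraph n) (hn : 3 ≤ n) :
    ∃ F : Finset (Sym2 V), (F : Set (Sym2 V)) ⊆ T.edgeSet ∧ F.card = 2 ∧
      (T.subdivide F).dominationNumber ≤ (n + 4) / 3 := by
  classical
  obtain ⟨x, hx⟩ := φ.exists_pathGraph_val_eq (j := 0) (by omega)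
  obtain ⟨y, hy⟩ := φ.exists_pathGraph_val_eq (j := 1) (by omega)
  obtain ⟨z, hz⟩ := φ.exists_pathGraph_val_eq (j := 2) (by omega)
  refine ⟨{s(x, y), s(y, z)}, ?_, ?_, φ.dominationNumber_subdivide_pair_le hx hy hz⟩
  · intro e he
    simp only [Finset.coe_insert, Finset.coe_singleton, Set.mem_insert_iff,
      Set.mem_singleton_iff] at he
    rcases he with rfl | rfl
    · exact (φ.pathGraph_adj_iff x y).2 (by omega)
    · exact (φ.pathGraph_adj_iff y z).2 (by omega)
  · rw [Finset.card_pair]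
    intro h
    rw [Sym2.eq_iff] at h
    rcases h with ⟨rfl, -⟩ | ⟨rfl, -⟩ <;> omega

theorem Iso.isGammaCritical_two_and_sd_eq_two {k : ℕ} (hk : 1 ≤ k)
    (φ : T ≃g pathGraph (3 * k + 2)) : T.IsGammaCritical 2 ∧ T.sd = 2 := by
  have hcard := φ.nat_card_of_pathGraph
  have hγ := φ.dominationNumber_le_of_pathGraph
  have hγ' := T.card_le_three_mul_dominationNumber φ.pathGraph_adj_eq_or_eq
  have hlow := T.card_add_card_le_three_mul_dominationNumber_subdivide φ.pathGraph_adj_eq_or_eq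
  have hsmall : ∀ F : Finset (Sym2 V), (F : Set (Sym2 V)) ⊆ T.edgeSet → F.card < 2 →
      ¬ T.SubdivisionIncreases F := by
    intro F hF hc h
    have h' : T.dominationNumber < (T.subdivide F).dominationNumber := h
    have hc' : F.card = 0 ∨ F.card = 1 := by omega
    rcases hc' with hc | hc
    · rw [Finset.card_eq_zero] at hc
      subst hc
      have := φ.dominationNumber_subdivide_empty_le
      omega
    · obtain ⟨e, rfl⟩ := Finset.card_eq_one.1 hc
      have := φ.dominationNumber_subdivide_le_of_mem_edgeSet (hF (by simp : e ∈ _))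
      omega
  have hbig : ∀ F : Finset (Sym2 V), (F : Set (Sym2 V)) ⊆ T.edgeSet → F.card = 2 →
      T.SubdivisionIncreases F := by
    intro F hF hc
    have := hlow F hF
    change T.dominationNumber < (T.subdivide F).dominationNumber
    omega
  obtain ⟨F, hF, hc, -⟩ := φ.exists_card_eq_two_of_pathGraph (by omega)
  refine ⟨⟨⟨by norm_num, ⟨F, hF, hc⟩, hbig⟩, ?_⟩, le_antisymm ?_ ?_⟩
  · rintro m ⟨-, ⟨F', hF', rfl⟩, h⟩
    by_contra! hlt
    exact hsmall F' hF' hlt (h F' hF' rfl)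
  · exact Nat.sInf_le ⟨F, hF, hc, hbig F hF hc⟩
  · refine le_csInf ⟨2, F, hF, hc, hbig F hF hc⟩ ?_
    rintro m ⟨F', hF', rfl, h⟩
    by_contra! hlt
    exact hsmall F' hF' hlt h

theorem IsTree.exists_iso_pathGraph_of_critical (hT : T.IsTree) (hn : 3 ≤ Nat.card V)
    (hcrit : T.IsGammaCritical 2) (hsd : T.sd = 2) :
    ∃ k : ℕ, 1 ≤ k ∧ Nonempty (T ≃g pathGraph (3 * k + 2)) := by
  have hA : ∀ e ∈ T.edgeSet, (T.subdivide {e}).dominationNumber ≤ T.dominationNumber := by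
    intro e he
    by_contra! hlt
    have : T.sd ≤ 1 := Nat.sInf_le ⟨{e}, by simpa using he, Finset.card_singleton e, hlt⟩
    omega
  have hB := hcrit.1.2.2
  have : Nontrivial V := Finite.one_lt_card_iff_nontrivial.1 (by omega)
  obtain ⟨φ⟩ := hT.nonempty_iso_pathGraph fun v N hN => hT.card_le_two_of_critical hA hB v N hN
  have hγ := φ.dominationNumber_le_of_pathGraph
  have hγ' := T.card_le_three_mul_dominationNumber φ.pathGraph_adj_eq_or_eq
  have hlow := T.card_add_card_le_three_mul_dominationNumber_subdivide φ.pathGraph_adj_eq_or_eq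
  obtain ⟨F, hF, hc, hFγ⟩ := φ.exists_card_eq_two_of_pathGraph hn
  have hlt : T.dominationNumber < (T.subdivide F).dominationNumber := hB F hF hc
  obtain ⟨e, he⟩ : F.Nonempty := Finset.card_pos.1 (by omega)
  have h1 := hA e (hF he)
  have h2 := hlow {e} (by simpa using hF he)
  rw [Finset.card_singleton] at h2
  -- With `n = Nat.card V`, the bounds give `n + 1 ≤ 3γ` and `γ < ⌊(n + 4)/3⌋`, excluding residue 1;
  -- `γ ≤ ⌊(n + 2)/3⌋` excludes residue 0.
  have hmod : Nat.card V = 3 * (Nat.card V / 3) + 2 := by omega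
  exact ⟨Nat.card V / 3, by omega, hmod ▸ ⟨φ⟩⟩

end PathSubdivision

end SimpleGraph

theorem mainTheorem4 {V : Type*} [Finite V] (T : SimpleGraph V) (hT : T.IsTree)
    (hn : 3 ≤ Nat.card V) :
    (T.IsGammaCritical 2 ∧ T.sd = 2) ↔
      ∃ k : ℕ, 1 ≤ k ∧ Nonempty (T ≃g SimpleGraph.pathGraph (3 * k + 2)) :=
  ⟨fun h => hT.exists_iso_pathGraph_of_critical hn h.1 h.2,
    fun ⟨_, hk, ⟨φ⟩⟩ => φ.isGammaCritical_two_and_sd_eq_two hk⟩
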